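/- **Generalized Funk–Hecke formula.** Let $\mathbb{S}^2\subset\mathbb{R}^3$ be the unit sphere with its standard surface measure $\mathrm{d}\Omega$ (total mass $4\pi$), and for $\ell=0,1,2,\dots$ let $P_\ell(t)=\frac{1}{2^\ell \ell!}\frac{\mathrm{d}^\ell}{\mathrm{d}t^\ell}(t^2-1)^\ell$ be the Legendre polynomial of degree $\ell$. Let $f$ be a real-valued function such that $t\mapsto(1-t)f(t)$ belongs to $L^1([-1,1])$. Then, for every $\ell\ge 0$ and all $\mathbf{x},\mathbf{y}\in\mathbb{S}^2$, the integral $$\gamma_\ell=\int_{-1}^1[P_\ell(t)-1]f(t)\,\mathrm{d}t$$ converges absolutely, and $$\int_{\mathbb{S}^2} f(\mathbf{x}\cdot\mathbf{z})\,[P_\ell(\mathbf{y}\cdot\mathbf{z})-P_\ell(\mathbf{x}\cdot\mathbf{y})]\,\mathrm{d}\Omega(\mathbf{z}) = 2\pi P_\ell(\mathbf{x}\cdot\mathbf{y})\,\gamma_\ell .$$ Here the integral over the sphere is understood as an improper integral at the point $\mathbf{x}$: for every $\varepsilon>0$ the integrand is absolutely integrable over $\{\mathbf{z}\in\mathbb{S}^2:\mathbf{x}\cdot\mathbf{z}<1-\varepsilon\}$,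 and the left-hand side is the limit as $\varepsilon\to0^+$ of the integrals over these sets. In particular, whenever the integrand is absolutely integrable over $\mathbb{S}^2$, the formula holds with the ordinary Lebesgue integral. -/

import Mathlib

open MeasureTheory Set Filter Topology

noncomputable section

/-- Euclidean three-space `ℝ³`. -/
abbrev E3 : Type := EuclideanSpace ℝ (Fin 3)

/-- The unit sphere `𝕊²` of `ℝ³`. -/
abbrev S2 : Type := Metric.sphere (0 : E3) 1

/-- The dot product `x · z` of two points of the sphere. -/
def S2.dot (x z : S2) : ℝ := inner ℝ (x : E3) (z : E3)

/-- The standard surface (solid angle) measure `dΩ = sin θ dθ dφ` on `𝕊²`, of total mass `4π`. -/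
def dΩ : Measure S2 := (volume : Measure E3).toSphere

/-- The Legendre polynomial of degree `ℓ`, by Rodrigues' formula
`P_ℓ(t) = (1 / (2 ^ ℓ ℓ!)) (d/dt) ^ ℓ (t ^ 2 - 1) ^ ℓ`. -/
def legendrePoly (ℓ : ℕ) : Polynomial ℝ :=
  Polynomial.C (1 / ((2 : ℝ) ^ ℓ * (ℓ.factorial : ℝ))) *
    (Polynomial.derivative^[ℓ] ((Polynomial.X ^ 2 - 1) ^ ℓ))

/-- The value `P_ℓ(t)`. -/
def legendreP (ℓ : ℕ) (t : ℝ) : ℝ := (legendrePoly ℓ).eval t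

/-- The sphere with the closed cap `{z : 1 - ε ≤ x · z ≤ 1}` around `x` removed. -/
def offCap (x : S2) (ε : ℝ) : Set S2 := {z | S2.dot x z < 1 - ε}

/-- `∫_{𝕊²} g dΩ = I` as an improper integral at the point `x`: the function `g` is absolutely
integrable off every cap around `x`, and its integrals off these caps converge to `I` as the caps
shrink to `x`. -/
def HasImproperIntegralAt (x : S2) (g : S2 → ℝ) (I : ℝ) : Prop :=
  (∀ ε : ℝ, 0 < ε → IntegrableOn g (offCap x ε) dΩ) ∧
    Tendsto (fun ε : ℝ => ∫ z in offCap x ε, g z ∂dΩ) (𝓝[>] 0) (𝓝 I)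

end

noncomputable section

/-! Off a cap around `x` the kernel is integrable, so the classical Funk–Hecke formula applies to
the truncated kernel. Subtracting `P_ℓ(x·y)` times its integral leaves `2π P_ℓ(x·y)` times the
integral of `(P_ℓ - 1) f` over `t < 1 - ε` (`setIntegral_offCap`). Since `P_ℓ(1) = 1`, the factor
`P_ℓ - 1` absorbs the singularity at `t = 1`, and dominated convergence gives the limit.

The classical formula (`integral_comp_dot_mul_legendreP`) follows by averaging `y` over its circle
of latitude about `x`: the integral is unchanged, while `P_ℓ(y·z)` averages to `P_ℓ(x·y) P_ℓ(x·z)`.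
Archimedes' theorem (`map_dot`) then reduces the sphere to `[-1, 1]`.

The product formula behind this average is algebraic: azimuthal averaging commutes with the Legendre
operator, whose polynomial eigenfunctions are determined by their eigenvalue and their value at `1`.
-/

/-! ### The Legendre operator and its polynomial eigenfunctions. -/

open Polynomial in
/-- The Legendre differential operator `p ↦ (1 - X ^ 2) p'' - 2 X p'`. -/
def legendreOp (p : Polynomial ℝ) : Polynomial ℝ :=
  (1 - X ^ 2) * derivative (derivative p) - 2 * X * derivative p

open Polynomial in
theorem iterate_derivative_legendreOp (p : Polynomial ℝ) (m : ℕ) :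
    derivative^[m] (legendreOp p) =
      (1 - X ^ 2) * derivative^[m + 2] p - 2 * ((m : Polynomial ℝ) + 1) * X * derivative^[m + 1] p
        - (m : Polynomial ℝ) * ((m : Polynomial ℝ) + 1) * derivative^[m] p := by
  induction m with
  | zero => simp [legendreOp]
  | succ m ih =>
    rw [Function.iterate_succ_apply', ih]
    simp only [derivative_sub, derivative_mul, derivative_X_pow, derivative_X, derivative_one,
      derivative_add, derivative_natCast, derivative_ofNat, ← Function.iterate_succ_apply']
    push_cast
    simp only [map_ofNat, Nat.succ_eq_add_one]
    ring

theorem legendreOp_add (p q : Polynomial ℝ) :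
    legendreOp (p + q) = legendreOp p + legendreOp q := by
  simp only [legendreOp, Polynomial.derivative_add]; ring

theorem legendreOp_C_mul (c : ℝ) (p : Polynomial ℝ) :
    legendreOp (Polynomial.C c * p) = Polynomial.C c * legendreOp p := by
  simp only [legendreOp, Polynomial.derivative_C_mul]; ring

theorem legendreOp_sum {ι : Type*} (s : Finset ι) (p : ι → Polynomial ℝ) :
    legendreOp (∑ i ∈ s, p i) = ∑ i ∈ s, legendreOp (p i) := by
  classical
  induction s using Finset.induction_on with
  | empty => simp [legendreOp]
  | insert a s ha ih => rw [Finset.sum_insert ha, Finset.sum_insert ha, legendreOp_add, ih]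

open Polynomial in
/-- A polynomial eigenfunction of the Legendre operator is determined by its
value at `1`. -/
theorem eq_zero_of_legendreOp_eq {q : Polynomial ℝ} {c : ℝ} (hq : legendreOp q = C c * q)
    (h1 : q.eval 1 = 0) : q = 0 := by
  -- At `1` the factor `1 - X ^ 2` vanishes, so the `m`-th derivative of the equation expresses `2
  -- (m + 1) q⁽ᵐ⁺¹⁾(1)` as a multiple of `q⁽ᵐ⁾(1)`.
  have key : ∀ m : ℕ, (derivative^[m] q).eval 1 = 0 := by
    intro m
    induction m with
    | zero => simpa using h1
    | succ m ih =>
      have h := congrArg (fun p => (derivative^[m] p).eval 1) hq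
      simp only [iterate_derivative_legendreOp, iterate_derivative_C_mul] at h
      simp [ih] at h
      exact h.resolve_left (by positivity)
  apply taylor_injective (1 : ℝ)
  ext n
  have h := congrFun (factorial_smul_hasseDeriv (R := ℝ) n) q
  have h2 := congrArg (fun p : Polynomial ℝ => p.eval 1) h
  simp only [key] at h2
  rw [taylor_coeff]
  simpa [Nat.factorial_ne_zero] using h2

-- Differentiate `(X ^ 2 - 1) u' = 2 ℓ X u`, where `u = (X ^ 2 - 1) ^ ℓ`, `m + 1` times and take `m
-- = ℓ`.
open Polynomial in
theorem legendreOp_legendrePoly (ℓ : ℕ) :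
    legendreOp (legendrePoly ℓ) = C (-((ℓ : ℝ) * (ℓ + 1))) * legendrePoly ℓ := by
  rw [legendrePoly, legendreOp_C_mul]
  set u : Polynomial ℝ := (X ^ 2 - 1) ^ ℓ with hu
  have h1 : (X ^ 2 - 1) * derivative u = 2 * (ℓ : Polynomial ℝ) * X * u := by
    rw [hu]
    cases ℓ with
    | zero => simp
    | succ j =>
      simp only [derivative_pow_succ, derivative_sub, derivative_one]
      simp
      ring
  have key : ∀ m : ℕ, (X ^ 2 - 1) * derivative^[m + 2] u
      + 2 * ((m : Polynomial ℝ) + 1 - (ℓ : Polynomial ℝ)) * X * derivative^[m + 1] u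
      + ((m : Polynomial ℝ) + 1) * ((m : Polynomial ℝ) - 2 * (ℓ : Polynomial ℝ)) * derivative^[m] u = 0 := by
    intro m
    induction m with
    | zero =>
      have h := congrArg derivative h1
      simp only [derivative_sub, derivative_mul, derivative_X_pow, derivative_X, derivative_one,
        derivative_natCast, derivative_ofNat] at h
      simp [← map_ofNat (C : ℝ →+* Polynomial ℝ) 2] at h ⊢
      linear_combination h
    | succ m ih =>
      have h := congrArg derivative ih
      simp only [derivative_sub, derivative_add, derivative_mul, derivative_X_pow, derivative_X,
        derivative_one, derivative_natCast, derivative_ofNat, derivative_zero,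
        ← Function.iterate_succ_apply'] at h
      push_cast at h ⊢
      simp only [Nat.succ_eq_add_one, map_ofNat] at h
      linear_combination h
  have h := key ℓ
  simp only [legendreOp, ← Function.iterate_succ_apply', Nat.succ_eq_add_one, map_neg, map_mul, map_add, map_natCast, map_one]
  linear_combination (-C (1 / (2 ^ ℓ * (ℓ.factorial : ℝ)))) * h

-- About the point `1`, `(X ^ 2 - 1) ^ ℓ` becomes `(X + 2) ^ ℓ X ^ ℓ`, whose coefficient at `X ^ ℓ`
-- is `2 ^ ℓ`.
open Polynomial in
theorem legendreP_one (ℓ : ℕ) : legendreP ℓ 1 = 1 := by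
  have h := congrFun (factorial_smul_hasseDeriv (R := ℝ) ℓ) ((X ^ 2 - 1) ^ ℓ)
  rw [legendreP, legendrePoly, ← h]
  have h2 : (hasseDeriv ℓ ((X ^ 2 - 1 : Polynomial ℝ) ^ ℓ)).eval 1 = 2 ^ ℓ := by
    rw [← taylor_coeff]
    have : taylor (1 : ℝ) ((X ^ 2 - 1) ^ ℓ) = (X + C 2) ^ ℓ * X ^ ℓ := by
      rw [taylor_pow, ← mul_pow]
      congr 1
      simp [taylor_apply]
      rw [show (C 2 : Polynomial ℝ) = 2 from map_ofNat C 2]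
      ring
    rw [this, coeff_mul_X_pow', if_pos le_rfl, Nat.sub_self, coeff_zero_eq_eval_zero]
    simp
  simp [h2]
  field_simp

/-! ### The azimuthal mean and the product formula. -/

-- The two correction terms are designed to telescope in the weighted sum over `k`. The truncated
-- exponent `k - 1` is harmless at `k = 0` because of the factor `k ^ 2`.
open Polynomial in
theorem legendreOp_comp_mul_pow (s c : ℝ) (hc : c = 1 - s ^ 2) (p : Polynomial ℝ) (k : ℕ) :
    legendreOp ((derivative^[2 * k] p).comp (C s * X) * (1 - X ^ 2) ^ k) =
      (derivative^[2 * k] (legendreOp p)).comp (C s * X) * (1 - X ^ 2) ^ k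
      + C (4 * (k : ℝ) ^ 2) * ((derivative^[2 * k] p).comp (C s * X) * (1 - X ^ 2) ^ (k - 1))
      - C c * ((derivative^[2 * (k + 1)] p).comp (C s * X) * (1 - X ^ 2) ^ k) := by
  subst hc
  rw [iterate_derivative_legendreOp, show 2 * (k + 1) = 2 * k + 2 by ring]
  have hD1 : derivative (derivative^[2 * k] p) = derivative^[2 * k + 1] p := by
    simp only [← Function.iterate_succ_apply', Nat.succ_eq_add_one]
  have hD2 : derivative (derivative^[2 * k + 1] p) = derivative^[2 * k + 2] p := by
    simp only [← Function.iterate_succ_apply', Nat.succ_eq_add_one]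
  rw [legendreOp]
  cases k with
  | zero =>
    simp [derivative_comp]
    ring
  | succ j =>
    have hV : (1 - X ^ 2 : Polynomial ℝ) * derivative ((1 - X ^ 2 : Polynomial ℝ) ^ j)
        = - 2 * (j : Polynomial ℝ) * X * (1 - X ^ 2 : Polynomial ℝ) ^ j := by
      cases j with
      | zero => simp
      | succ i =>
        simp only [derivative_pow_succ, derivative_sub, derivative_one]
        simp
        ring
    simp only [derivative_mul, derivative_comp, hD1, hD2, derivative_pow_succ,
      derivative_add, derivative_sub, derivative_one, derivative_C, derivative_natCast,
      derivative_X, derivative_zero, sub_comp, mul_comp, add_comp, pow_comp, X_comp, one_comp,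
      natCast_comp, ofNat_comp, Nat.add_sub_cancel, C_sub, C_mul, C_pow, C_add, C_1,
      map_natCast, map_ofNat]
    push_cast
    generalize (derivative^[2 * (j + 1)] p).comp (C s * X) = a0 at *
    linear_combination (-2 * ((j : Polynomial ℝ) + 1) * X * a0) * hV

open Polynomial in
/-- The mean of `p (s t + √(1 - s ^ 2) √(1 - t ^ 2) cos φ)` over `φ`, as a polynomial in `t`;
the sum is complete as soon as `2 * N` exceeds the degree of `p`. -/
def azimuthalMean (s : ℝ) (N : ℕ) (p : Polynomial ℝ) : Polynomial ℝ :=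
  ∑ k ∈ Finset.range N, C ((1 - s ^ 2) ^ k / (4 ^ k * (k.factorial : ℝ) ^ 2)) *
    ((derivative^[2 * k] p).comp (C s * X) * (1 - X ^ 2) ^ k)

open Polynomial in
theorem legendreOp_azimuthalMean (s : ℝ) (N : ℕ) (p : Polynomial ℝ) (hN : p.natDegree < 2 * N) :
    legendreOp (azimuthalMean s N p) = azimuthalMean s N (legendreOp p) := by
  -- The telescoping boundary terms: `e 0` vanishes by its factor `k ^ 2`, `e N` because `2 * N`
  -- exceeds the degree.
  set e : ℕ → Polynomial ℝ := fun k =>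
    C ((1 - s ^ 2) ^ k / (4 ^ k * (k.factorial : ℝ) ^ 2) * (4 * (k : ℝ) ^ 2)) *
      ((derivative^[2 * k] p).comp (C s * X) * (1 - X ^ 2) ^ (k - 1)) with he
  have h0 : e 0 = 0 := by simp [he]
  have hlast : e N = 0 := by simp [he, iterate_derivative_eq_zero hN]
  have hterm : ∀ k, legendreOp (C ((1 - s ^ 2) ^ k / (4 ^ k * (k.factorial : ℝ) ^ 2)) *
      ((derivative^[2 * k] p).comp (C s * X) * (1 - X ^ 2) ^ k)) =
      C ((1 - s ^ 2) ^ k / (4 ^ k * (k.factorial : ℝ) ^ 2)) *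
        ((derivative^[2 * k] (legendreOp p)).comp (C s * X) * (1 - X ^ 2) ^ k)
        + (e k - e (k + 1)) := by
    intro k
    rw [legendreOp_C_mul, legendreOp_comp_mul_pow s _ rfl]
    have hcoef : (1 - s ^ 2) ^ (k + 1) / (4 ^ (k + 1) * ((k + 1).factorial : ℝ) ^ 2) *
        (4 * ((k + 1 : ℕ) : ℝ) ^ 2) =
        (1 - s ^ 2) ^ k / (4 ^ k * (k.factorial : ℝ) ^ 2) * (1 - s ^ 2) := by
      rw [Nat.factorial_succ]
      push_cast
      field_simp
      ring
    simp only [he, hcoef, Nat.add_sub_cancel]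
    simp only [C_mul]
    ring
  rw [azimuthalMean, legendreOp_sum, Finset.sum_congr rfl fun k _ => hterm k,
    Finset.sum_add_distrib, Finset.sum_range_sub', h0, hlast, sub_zero, add_zero, azimuthalMean]

open Polynomial in
theorem eval_one_azimuthalMean (s : ℝ) (N : ℕ) (hN : 0 < N) (p : Polynomial ℝ) :
    (azimuthalMean s N p).eval 1 = p.eval s := by
  obtain ⟨n, rfl⟩ := Nat.exists_eq_succ_of_ne_zero hN.ne'
  rw [azimuthalMean, Finset.sum_range_succ']
  simp [eval_finsetSum]

open Polynomial in
theorem azimuthalMean_C_mul (s c : ℝ) (N : ℕ) (p : Polynomial ℝ) :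
    azimuthalMean s N (C c * p) = C c * azimuthalMean s N p := by
  simp only [azimuthalMean, iterate_derivative_C_mul, mul_comp, C_comp, Finset.mul_sum]
  exact Finset.sum_congr rfl fun k _ => by ring

/-- The product formula for Legendre polynomials, in algebraic form. -/
theorem azimuthalMean_legendrePoly (s : ℝ) (N ℓ : ℕ) (hN : (legendrePoly ℓ).natDegree < 2 * N) :
    azimuthalMean s N (legendrePoly ℓ) = Polynomial.C (legendreP ℓ s) * legendrePoly ℓ := by
  rw [← sub_eq_zero]
  have h1 := legendreP_one ℓ
  rw [legendreP] at h1
  refine eq_zero_of_legendreOp_eq (c := -((ℓ : ℝ) * (ℓ + 1))) ?_ ?_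
  · rw [sub_eq_add_neg, ← neg_mul, ← Polynomial.C_neg, legendreOp_add, legendreOp_C_mul,
      legendreOp_azimuthalMean s N _ hN, legendreOp_legendrePoly, azimuthalMean_C_mul]
    ring
  · simp [eval_one_azimuthalMean s N (by lia), h1, legendreP]

theorem integral_cos_pow_even (k : ℕ) :
    ∫ φ in (0 : ℝ)..2 * Real.pi, Real.cos φ ^ (2 * k) =
      2 * Real.pi * ((2 * k).factorial / (4 ^ k * (k.factorial : ℝ) ^ 2)) := by
  induction k with
  | zero => simp
  | succ k ih =>
    rw [show 2 * (k + 1) = 2 * k + 2 by ring, integral_cos_pow, ih, Nat.factorial_succ,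
      Nat.factorial_succ, Nat.factorial_succ]
    simp
    field_simp
    ring

theorem integral_cos_pow_odd (k : ℕ) :
    ∫ φ in (0 : ℝ)..2 * Real.pi, Real.cos φ ^ (2 * k + 1) = 0 := by
  induction k with
  | zero => simp
  | succ k ih =>
    rw [show 2 * (k + 1) + 1 = 2 * k + 1 + 2 by ring, integral_cos_pow, ih]
    simp

theorem sum_range_two_mul {M : Type*} [AddCommMonoid M] (f : ℕ → M) (N : ℕ) :
    ∑ m ∈ Finset.range (2 * N), f m = ∑ k ∈ Finset.range N, (f (2 * k) + f (2 * k + 1)) := by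
  induction N with
  | zero => simp
  | succ N ih =>
    rw [show 2 * (N + 1) = 2 * N + 1 + 1 by ring, Finset.sum_range_succ, Finset.sum_range_succ, ih,
      Finset.sum_range_succ, add_assoc]

open Polynomial in
theorem eval_add_eq_sum_iterate_derivative (p : Polynomial ℝ) (w h : ℝ) (M : ℕ)
    (hM : p.natDegree < M) :
    p.eval (w + h) = ∑ m ∈ Finset.range M, (derivative^[m] p).eval w / m.factorial * h ^ m := by
  rw [add_comm w h, ← taylor_eval, eval_eq_sum_range' (n := M) (by simpa using hM)]
  refine Finset.sum_congr rfl fun m _ => ?_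
  rw [taylor_coeff, ← factorial_smul_hasseDeriv (R := ℝ) m]
  congr 1
  simp [Nat.factorial_ne_zero]

-- Taylor expansion at `w`: odd powers of the cosine integrate to zero, and for even ones `(2k)!`
-- cancels, leaving the coefficients of `azimuthalMean`.
open Polynomial in
theorem integral_eval_add_mul_cos (p : Polynomial ℝ) (w c : ℝ) (N : ℕ)
    (hN : p.natDegree < 2 * N) :
    ∫ φ in (0 : ℝ)..2 * Real.pi, p.eval (w + c * Real.cos φ) =
      2 * Real.pi * ∑ k ∈ Finset.range N,
        (derivative^[2 * k] p).eval w / (4 ^ k * (k.factorial : ℝ) ^ 2) * (c ^ 2) ^ k := by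
  simp_rw [eval_add_eq_sum_iterate_derivative p w _ _ hN, mul_pow, ← mul_assoc]
  rw [intervalIntegral.integral_finsetSum
    fun m _ => Continuous.intervalIntegrable (by fun_prop) _ _]
  simp_rw [intervalIntegral.integral_const_mul]
  rw [sum_range_two_mul, Finset.mul_sum]
  refine Finset.sum_congr rfl fun k _ => ?_
  rw [integral_cos_pow_even, integral_cos_pow_odd]
  field_simp
  ring

open Polynomial in
/-- The product formula for Legendre polynomials. -/
theorem integral_legendreP_mul_add_mul_cos (ℓ : ℕ) (s t c : ℝ)
    (hc : c ^ 2 = (1 - s ^ 2) * (1 - t ^ 2)) :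
    ∫ φ in (0 : ℝ)..2 * Real.pi, legendreP ℓ (s * t + c * Real.cos φ) =
      2 * Real.pi * (legendreP ℓ s * legendreP ℓ t) := by
  have hN : (legendrePoly ℓ).natDegree < 2 * ((legendrePoly ℓ).natDegree + 1) := by lia
  have h := congrArg (eval t) (azimuthalMean_legendrePoly s _ ℓ hN)
  simp only [legendreP] at h ⊢
  rw [integral_eval_add_mul_cos _ _ _ _ hN]
  rw [eval_mul, eval_C] at h
  rw [← h, azimuthalMean, eval_finsetSum]
  congr 1
  refine Finset.sum_congr rfl fun k _ => ?_
  simp [hc, mul_pow]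
  ring

theorem continuous_legendreP (ℓ : ℕ) : Continuous (legendreP ℓ) :=
  (legendrePoly ℓ).continuous

/-- The mean of a Legendre polynomial along a circle of latitude. -/
theorem integral_legendreP_circle (ℓ : ℕ) (s t p q σ : ℝ) (hσ : σ ^ 2 = 1 - s ^ 2)
    (hpq : t ^ 2 + p ^ 2 + q ^ 2 = 1) :
    ∫ φ in (0 : ℝ)..2 * Real.pi,
        legendreP ℓ (s * t + σ * (p * Real.cos φ + q * Real.sin φ)) =
      2 * Real.pi * (legendreP ℓ s * legendreP ℓ t) := by
  -- Polar coordinates for `(p, q)` merge sine and cosine into one phase-shifted cosine; periodicity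
  -- removes the phase.
  set w : ℂ := ⟨p, q⟩ with hw
  have hp : p = ‖w‖ * Real.cos w.arg := (Complex.norm_mul_cos_arg w).symm
  have hq : q = ‖w‖ * Real.sin w.arg := (Complex.norm_mul_sin_arg w).symm
  have hn : ‖w‖ ^ 2 = 1 - t ^ 2 := by
    rw [Complex.sq_norm, Complex.normSq_mk]
    linarith
  have hfun : ∀ φ, s * t + σ * (p * Real.cos φ + q * Real.sin φ) =
      s * t + σ * ‖w‖ * Real.cos (φ - w.arg) := by
    intro φ
    rw [Real.cos_sub]
    conv_lhs => rw [hp, hq]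
    ring
  simp_rw [hfun]
  rw [intervalIntegral.integral_comp_sub_right
    (fun φ => legendreP ℓ (s * t + σ * ‖w‖ * Real.cos φ))]
  have hper : Function.Periodic (fun φ => legendreP ℓ (s * t + σ * ‖w‖ * Real.cos φ))
      (2 * Real.pi) := fun φ => by simp
  have h := hper.intervalIntegral_add_eq (0 - w.arg) 0
  rw [zero_add] at h
  rw [show 2 * Real.pi - w.arg = 0 - w.arg + 2 * Real.pi by ring, h]
  exact integral_legendreP_mul_add_mul_cos ℓ s t _ (by rw [mul_pow, hσ, hn])

/-! ### The distribution of heights on the sphere. -/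

theorem S2.continuous_dot (x : S2) : Continuous (S2.dot x) := by
  unfold S2.dot; fun_prop

theorem S2.dot_mem_Icc (x z : S2) : S2.dot x z ∈ Icc (-1 : ℝ) 1 := by
  have h := abs_real_inner_le_norm (x : E3) (z : E3)
  rw [norm_eq_of_mem_sphere, norm_eq_of_mem_sphere, mul_one] at h
  exact abs_le.mp h

instance : IsFiniteMeasure dΩ := by
  unfold dΩ; infer_instance

theorem S2.exists_basis (x : S2) : ∃ b : OrthonormalBasis (Fin 3) ℝ E3, b 0 = x := by
  have hv : Orthonormal ℝ (({0} : Set (Fin 3)).domRestrict fun _ => (x : E3)) := by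
    rw [orthonormal_iff_ite]
    rintro ⟨i, hi⟩ ⟨j, hj⟩
    have hi' : i = 0 := hi
    have hj' : j = 0 := hj
    subst hi' hj'
    simp
  obtain ⟨b, hb⟩ := hv.exists_orthonormalBasis_extension_of_card_eq (by simp)
  exact ⟨b, hb 0 rfl⟩

/-- Gaussian moments, evaluated here in Cartesian coordinates and next in polar ones, yield the
moments of the height. The two coordinates orthogonal to `x` contribute `√π` each. -/
theorem integral_inner_pow_mul_exp (x : S2) (n : ℕ) :
    ∫ v : E3, (inner ℝ (x : E3) v) ^ n * Real.exp (-‖v‖ ^ 2) =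
      Real.pi * ∫ u : ℝ, u ^ n * Real.exp (-u ^ 2) := by
  obtain ⟨b, hb⟩ := S2.exists_basis x
  have h1 : ∫ v : E3, (inner ℝ (x : E3) v) ^ n * Real.exp (-‖v‖ ^ 2) =
      ∫ v : E3, (v 0) ^ n * Real.exp (-‖v‖ ^ 2) := by
    rw [← b.measurePreserving_repr.integral_comp b.repr.toHomeomorph.measurableEmbedding
      (fun v : E3 => (v 0) ^ n * Real.exp (-‖v‖ ^ 2))]
    simp [b.repr_apply_apply, hb]
  have h2 : ∫ v : E3, (v 0) ^ n * Real.exp (-‖v‖ ^ 2) =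
      ∫ v : Fin 3 → ℝ, ∏ i, ((if i = 0 then v i ^ n else 1) * Real.exp (-(v i) ^ 2)) := by
    rw [← (PiLp.volume_preserving_toLp (Fin 3)).integral_comp
      (MeasurableEquiv.toLp 2 (Fin 3 → ℝ)).measurableEmbedding]
    refine integral_congr_ae (ae_of_all _ fun v => ?_)
    simp only [Fin.prod_univ_three, EuclideanSpace.norm_sq_eq, Fin.sum_univ_three]
    simp [Real.exp_add]
    ring
  rw [h1, h2, integral_fintype_prod_volume_eq_prod
    (f := fun i (u : ℝ) => (if i = 0 then u ^ n else 1) * Real.exp (-u ^ 2))]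
  have hg : ∫ u : ℝ, Real.exp (-u ^ 2) = √Real.pi := by
    simpa using integral_gaussian 1
  simp only [Fin.prod_univ_three]
  simp [hg]
  rw [mul_assoc, Real.mul_self_sqrt Real.pi_pos.le, mul_comm]

theorem integral_inner_pow_mul_exp_polar (x : S2) (n : ℕ) :
    ∫ v : E3, (inner ℝ (x : E3) v) ^ n * Real.exp (-‖v‖ ^ 2) =
      (∫ z, S2.dot x z ^ n ∂dΩ) * ∫ r in Ioi (0 : ℝ), r ^ (n + 2) * Real.exp (-r ^ 2) := by
  have hd : Module.finrank ℝ E3 - 1 = 2 := by simp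
  calc
    _ = ∫ v : ({(0)}ᶜ : Set E3), (inner ℝ (x : E3) (v : E3)) ^ n * Real.exp (-‖(v : E3)‖ ^ 2)
          ∂((volume : Measure E3).comap (↑)) := by
      rw [integral_subtype_comap (measurableSet_singleton _).compl
        fun v : E3 => (inner ℝ (x : E3) v) ^ n * Real.exp (-‖v‖ ^ 2), restrict_compl_singleton]
    _ = ∫ w, S2.dot x w.1 ^ n * ((w.2 : ℝ) ^ n * Real.exp (-(w.2 : ℝ) ^ 2))
          ∂(dΩ.prod (.volumeIoiPow (Module.finrank ℝ E3 - 1))) := by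
      rw [dΩ, ← (volume : Measure E3).measurePreserving_homeomorphUnitSphereProd.integral_comp
        (Homeomorph.measurableEmbedding _)]
      refine integral_congr_ae (ae_of_all _ fun v => ?_)
      have hv : ‖(v : E3)‖ ≠ 0 := norm_ne_zero_iff.mpr v.2
      simp only [S2.dot, homeomorphUnitSphereProd_apply_fst_coe,
        homeomorphUnitSphereProd_apply_snd_coe, inner_smul_right, ← mul_assoc, ← mul_pow]
      field_simp
    _ = (∫ z, S2.dot x z ^ n ∂dΩ) * ∫ r : Ioi (0 : ℝ), ((r : ℝ) ^ n * Real.exp (-(r : ℝ) ^ 2))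
          ∂(.volumeIoiPow (Module.finrank ℝ E3 - 1)) :=
      integral_prod_mul (fun z => S2.dot x z ^ n)
        fun r : Ioi (0 : ℝ) => ((r : ℝ) ^ n * Real.exp (-(r : ℝ) ^ 2))
    _ = _ := by
      rw [hd]
      simp only [Measure.volumeIoiPow, ENNReal.ofReal]
      rw [integral_withDensity_eq_integral_smul,
        integral_subtype_comap measurableSet_Ioi
          fun a ↦ Real.toNNReal (a ^ 2) • (a ^ n * Real.exp (-a ^ 2)),
        setIntegral_congr_fun measurableSet_Ioi fun r hr ↦ ?_]
      · simp only [NNReal.smul_def, Real.coe_toNNReal _ (sq_nonneg _), smul_eq_mul]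
        ring
      · exact (measurable_subtype_coe.pow_const _).real_toNNReal

theorem integral_Ioi_pow_mul_exp (n : ℕ) :
    ∫ r in Ioi (0 : ℝ), r ^ n * Real.exp (-r ^ 2) = 1 / 2 * Real.Gamma (((n : ℝ) + 1) / 2) := by
  rw [← integral_rpow_mul_exp_neg_rpow (p := 2) (q := n) (by norm_num)
    (by linarith [(n.cast_nonneg : (0 : ℝ) ≤ n)])]
  simp

theorem integral_pow_mul_exp_of_even {n : ℕ} (hn : Even n) :
    ∫ u : ℝ, u ^ n * Real.exp (-u ^ 2) = Real.Gamma (((n : ℝ) + 1) / 2) := by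
  have h := integral_comp_abs (f := fun u : ℝ => u ^ n * Real.exp (-u ^ 2))
  simp only [hn.pow_abs, sq_abs] at h
  rw [h, integral_Ioi_pow_mul_exp]
  ring

theorem integral_pow_mul_exp_of_odd {n : ℕ} (hn : Odd n) :
    ∫ u : ℝ, u ^ n * Real.exp (-u ^ 2) = 0 := by
  have h := integral_neg_eq_self (fun u : ℝ => u ^ n * Real.exp (-u ^ 2)) volume
  simp only [hn.neg_pow, neg_sq, neg_mul, integral_neg] at h
  linarith

/-- The moments of the height function on the sphere. -/
theorem integral_dot_pow (x : S2) (n : ℕ) :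
    ∫ z, S2.dot x z ^ n ∂dΩ = 2 * Real.pi * ∫ t in (-1 : ℝ)..1, t ^ n := by
  have h := (integral_inner_pow_mul_exp_polar x n).symm.trans (integral_inner_pow_mul_exp x n)
  have hpos : 0 < ((n : ℝ) + 1) / 2 := by positivity
  rw [integral_Ioi_pow_mul_exp] at h
  have hG : Real.Gamma ((((n + 2 : ℕ) : ℝ) + 1) / 2) =
      ((n : ℝ) + 1) / 2 * Real.Gamma (((n : ℝ) + 1) / 2) := by
    rw [← Real.Gamma_add_one hpos.ne']
    congr 1
    push_cast
    ring
  have hG0 := Real.Gamma_pos_of_pos hpos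
  rw [hG] at h
  rw [integral_pow]
  rcases Nat.even_or_odd n with hn | hn
  · rw [integral_pow_mul_exp_of_even hn] at h
    rw [hn.add_one.neg_one_pow]
    field_simp at h ⊢
    linear_combination h
  · rw [integral_pow_mul_exp_of_odd hn, mul_zero] at h
    rw [hn.add_one.neg_one_pow]
    have hne : 1 / 2 * (((n : ℝ) + 1) / 2 * Real.Gamma (((n : ℝ) + 1) / 2)) ≠ 0 := by positivity
    simpa using (mul_eq_zero.mp h).resolve_right hne

/-- Two finite measures on the line carried by a compact interval agree as soon as they have the
same moments. -/
theorem measure_ext_of_moments {a b : ℝ} {μ ν : Measure ℝ} [IsFiniteMeasure μ] [IsFiniteMeasure ν]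
    (hμ : ∀ᵐ t ∂μ, t ∈ Icc a b) (hν : ∀ᵐ t ∂ν, t ∈ Icc a b)
    (h : ∀ n : ℕ, ∫ t, t ^ n ∂μ = ∫ t, t ^ n ∂ν) : μ = ν := by
  have hint : ∀ (ρ : Measure ℝ) [IsFiniteMeasure ρ], (∀ᵐ t ∂ρ, t ∈ Icc a b) →
      ∀ g : ℝ → ℝ, Continuous g → Integrable g ρ := by
    intro ρ _ hρ g hg
    obtain ⟨C, hC⟩ := isCompact_Icc.exists_bound_of_continuousOn (s := Icc a b) hg.continuousOn
    exact Integrable.of_bound hg.aestronglyMeasurable C (hρ.mono hC)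
  have hpoly : ∀ p : Polynomial ℝ, ∫ t, p.eval t ∂μ = ∫ t, p.eval t ∂ν := by
    intro p
    simp_rw [Polynomial.eval_eq_sum_range]
    rw [integral_finsetSum _ fun i _ => hint μ hμ _ (by fun_prop),
      integral_finsetSum _ fun i _ => hint ν hν _ (by fun_prop)]
    simp_rw [integral_const_mul, h]
  refine ext_of_forall_integral_eq_of_IsFiniteMeasure fun g => ?_
  refine eq_of_forall_dist_le fun ε hε => ?_
  -- The two approximation errors add up to at most `ε`; the `+ 1` keeps the divisor positive.
  set M := μ.real univ + ν.real univ + 1 with hM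
  have hMpos : 0 < M := by positivity
  obtain ⟨p, hp⟩ := exists_polynomial_near_of_continuousOn a b g g.continuous.continuousOn (ε / M)
    (by positivity)
  have hbound : ∀ (ρ : Measure ℝ) [IsFiniteMeasure ρ], (∀ᵐ t ∂ρ, t ∈ Icc a b) →
      |∫ t, p.eval t ∂ρ - ∫ t, g t ∂ρ| ≤ ε / M * ρ.real univ := by
    intro ρ _ hρ
    rw [← integral_sub (hint ρ hρ _ p.continuous) (hint ρ hρ _ g.continuous)]
    rw [← Real.norm_eq_abs]
    exact norm_integral_le_of_norm_le_const (hρ.mono fun t ht => (hp t ht).le)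
  have h1 := abs_le.mp (hbound μ hμ)
  have h2 := abs_le.mp (hbound ν hν)
  rw [hpoly p] at h1
  have h3 : ε / M * μ.real univ + ε / M * ν.real univ ≤ ε := by
    have : ε / M * M = ε := by field_simp
    have hpos : 0 < ε / M := by positivity
    nlinarith
  rw [Real.dist_eq, abs_le]
  constructor <;> linarith [h1.1, h1.2, h2.1, h2.2]

/-- Archimedes' theorem: the height function sends the surface measure of the sphere to a multiple
of the Lebesgue measure on `[-1, 1]`. -/
theorem map_dot (x : S2) :
    Measure.map (S2.dot x) dΩ =
      ENNReal.ofReal (2 * Real.pi) • (volume : Measure ℝ).restrict (Icc (-1) 1) := by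
  have hm : Measurable (S2.dot x) := (S2.continuous_dot x).measurable
  have : IsFiniteMeasure (ENNReal.ofReal (2 * Real.pi) • (volume : Measure ℝ).restrict
      (Icc (-1) 1)) := Measure.smul_finite _ ENNReal.ofReal_ne_top
  refine measure_ext_of_moments (a := -1) (b := 1) ?_ ?_ fun n => ?_
  · refine (ae_map_iff hm.aemeasurable (p := fun t => t ∈ Icc (-1 : ℝ) 1) measurableSet_Icc).mpr ?_
    exact ae_of_all _ (S2.dot_mem_Icc x)
  · exact Measure.ae_smul_measure (ae_restrict_mem measurableSet_Icc) _
  · rw [integral_map hm.aemeasurable (by fun_prop), integral_dot_pow, integral_smul_measure,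
      ENNReal.toReal_ofReal (by positivity), integral_Icc_eq_integral_Ioc,
      ← intervalIntegral.integral_of_le (by norm_num), smul_eq_mul]

theorem integrable_comp_dot {g : ℝ → ℝ} (hg : IntegrableOn g (Icc (-1) 1)) (x : S2) :
    Integrable (fun z => g (S2.dot x z)) dΩ := by
  have h : Integrable g (Measure.map (S2.dot x) dΩ) := by
    rw [map_dot]
    exact Integrable.smul_measure hg ENNReal.ofReal_ne_top
  exact h.comp_measurable (S2.continuous_dot x).measurable

theorem integral_comp_dot {g : ℝ → ℝ} (hg : IntegrableOn g (Icc (-1) 1)) (x : S2) :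
    ∫ z, g (S2.dot x z) ∂dΩ = 2 * Real.pi * ∫ t in (-1 : ℝ)..1, g t := by
  have h : Integrable g (Measure.map (S2.dot x) dΩ) := by
    rw [map_dot]
    exact Integrable.smul_measure hg ENNReal.ofReal_ne_top
  rw [← integral_map (S2.continuous_dot x).measurable.aemeasurable h.aestronglyMeasurable, map_dot,
    integral_smul_measure, ENNReal.toReal_ofReal (by positivity), integral_Icc_eq_integral_Ioc,
    ← intervalIntegral.integral_of_le (by norm_num), smul_eq_mul]

/-! ### Symmetry and the classical Funk–Hecke formula. -/

/-- The action of a linear isometry of `ℝ³` on the sphere. -/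
def S2.map (T : E3 ≃ₗᵢ[ℝ] E3) (z : S2) : S2 := ⟨T z, by simp⟩

-- The surface measure is defined through volumes of cones over sets, and isometries preserve these.
open scoped Pointwise in
theorem S2.measurePreserving_map (T : E3 ≃ₗᵢ[ℝ] E3) : MeasurePreserving (S2.map T) dΩ dΩ := by
  have hc : Continuous (S2.map T) := by unfold S2.map; fun_prop
  refine ⟨hc.measurable, Measure.ext fun s hs => ?_⟩
  rw [Measure.map_apply hc.measurable hs, dΩ, Measure.toSphere_apply' _ hs,
    Measure.toSphere_apply' _ (hc.measurable hs),
    ← T.measurePreserving.measure_preimage_emb T.toHomeomorph.measurableEmbedding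
      (Ioo (0 : ℝ) 1 • (((↑) : S2 → E3) '' s))]
  congr 2
  ext v
  simp only [Set.mem_smul, Set.mem_preimage, Set.mem_image]
  constructor
  · rintro ⟨r, hr, _, ⟨z, hz, rfl⟩, rfl⟩
    exact ⟨r, hr, _, ⟨_, hz, rfl⟩, by simp [S2.map]⟩
  · rintro ⟨r, hr, _, ⟨z, hz, rfl⟩, h⟩
    refine ⟨r, hr, _, ⟨S2.map T.symm z, ?_, rfl⟩, ?_⟩
    · simpa [S2.map] using hz
    · apply T.injective
      simp [S2.map, ← h]

/-- The reflection in the plane orthogonal to `y - y'` sends `y` to `y'`, and fixes `x` because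
`x·(y - y') = 0`. -/
theorem integral_comp_dot_dot_congr (G : ℝ → ℝ → ℝ) {x y y' : S2}
    (h : S2.dot x y = S2.dot x y') :
    ∫ z, G (S2.dot x z) (S2.dot y z) ∂dΩ = ∫ z, G (S2.dot x z) (S2.dot y' z) ∂dΩ := by
  set K : Submodule ℝ E3 := (Submodule.span ℝ {(y : E3) - y'})ᗮ with hK
  set T : E3 ≃ₗᵢ[ℝ] E3 := K.reflection with hT
  have hTy : T y = y' :=
    Submodule.reflection_sub (by rw [norm_eq_of_mem_sphere, norm_eq_of_mem_sphere])
  have hTx : T x = x := by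
    refine Submodule.reflection_mem_subspace_eq_self ?_
    rw [hK, Submodule.mem_orthogonal_singleton_iff_inner_left, inner_sub_right]
    exact sub_eq_zero.mpr h
  have hemb : MeasurableEmbedding (S2.map T) := by
    have hc : ∀ T : E3 ≃ₗᵢ[ℝ] E3, Continuous (S2.map T) := fun T => by unfold S2.map; fun_prop
    exact (Homeomorph.mk ⟨S2.map T, S2.map T.symm, fun z => by simp [S2.map],
      fun z => by simp [S2.map]⟩ (hc T) (hc T.symm)).measurableEmbedding
  rw [← (S2.measurePreserving_map T).integral_comp hemb
    (fun z => G (S2.dot x z) (S2.dot y' z))]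
  have h1 : ∀ z, S2.dot x (S2.map T z) = S2.dot x z := fun z => by
    rw [S2.dot, S2.dot, ← T.inner_map_map x z, hTx]; rfl
  have h2 : ∀ z, S2.dot y' (S2.map T z) = S2.dot y z := fun z => by
    rw [S2.dot, S2.dot, ← T.inner_map_map y z, hTy]; rfl
  simp_rw [h1, h2]

/-- The circle of latitude of `y` about the axis `x`, with the coordinates `p`, `q` in the plane
orthogonal to `x`. -/
theorem S2.exists_circle (x y : S2) : ∃ (Y : ℝ → S2) (p q : S2 → ℝ) (σ : ℝ),
    Continuous p ∧ Continuous q ∧ σ ^ 2 = 1 - S2.dot x y ^ 2 ∧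
    (∀ φ, S2.dot x (Y φ) = S2.dot x y) ∧
    (∀ z, S2.dot x z ^ 2 + p z ^ 2 + q z ^ 2 = 1) ∧
    ∀ φ z, S2.dot (Y φ) z =
      S2.dot x y * S2.dot x z + σ * (p z * Real.cos φ + q z * Real.sin φ) := by
  obtain ⟨b, hb⟩ := S2.exists_basis x
  have hs := S2.dot_mem_Icc x y
  set s := S2.dot x y with hsdef
  have hσ : √(1 - s ^ 2) ^ 2 = 1 - s ^ 2 := Real.sq_sqrt (by nlinarith [hs.1, hs.2])
  set σ := √(1 - s ^ 2)
  set v : ℝ → E3 := fun φ => b.repr.symm !₂[s, σ * Real.cos φ, σ * Real.sin φ] with hv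
  have hnorm : ∀ φ, v φ ∈ Metric.sphere (0 : E3) 1 := by
    intro φ
    rw [mem_sphere_zero_iff_norm, hv, LinearIsometryEquiv.norm_map, EuclideanSpace.norm_eq]
    simp [Fin.sum_univ_three, mul_pow, hσ]
    linear_combination (1 - s ^ 2) * Real.sin_sq_add_cos_sq φ
  have hin : ∀ φ (w : E3), inner ℝ (v φ) w = s * inner ℝ (b 0) w +
      σ * (inner ℝ (b 1) w * Real.cos φ + inner ℝ (b 2) w * Real.sin φ) := by
    intro φ w
    rw [← b.repr.inner_map_map, hv, LinearIsometryEquiv.apply_symm_apply]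
    simp [PiLp.inner_apply, Fin.sum_univ_three, b.repr_apply_apply]
    ring
  refine ⟨fun φ => ⟨v φ, hnorm φ⟩, fun z => inner ℝ (b 1) (z : E3), fun z => inner ℝ (b 2) (z : E3),
    σ, by fun_prop, by fun_prop, hσ, fun φ => ?_, fun z => ?_, fun φ z => ?_⟩
  · rw [S2.dot, ← hb, real_inner_comm, hin]
    simp
  · have h := b.sum_sq_norm_inner_right (z : E3)
    simpa [Fin.sum_univ_three, hb, S2.dot] using h
  · rw [S2.dot, hin, hb]
    rfl

/-- The Funk–Hecke formula for integrable kernels. -/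
theorem integral_comp_dot_mul_legendreP {g : ℝ → ℝ} (hg : IntegrableOn g (Icc (-1) 1)) (ℓ : ℕ)
    (x y : S2) :
    ∫ z, g (S2.dot x z) * legendreP ℓ (S2.dot y z) ∂dΩ =
      2 * Real.pi * legendreP ℓ (S2.dot x y) * ∫ t in (-1 : ℝ)..1, g t * legendreP ℓ t := by
  obtain ⟨Y, p, q, σ, hp, hq, hσ, hxY, hpq, hY⟩ := S2.exists_circle x y
  set s := S2.dot x y
  obtain ⟨C, hC⟩ := isCompact_Icc.exists_bound_of_continuousOn (s := Icc (-1 : ℝ) 1)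
    (continuous_legendreP ℓ).continuousOn
  have hcd := S2.continuous_dot x
  have hcont : Continuous fun w : ℝ × S2 => legendreP ℓ (S2.dot (Y w.1) w.2) := by
    simp_rw [hY]
    exact (continuous_legendreP ℓ).comp (by fun_prop)
  have hint : Integrable
      (Function.uncurry fun φ z => g (S2.dot x z) * legendreP ℓ (S2.dot (Y φ) z))
      ((volume.restrict (uIoc 0 (2 * Real.pi))).prod dΩ) := by
    have : IsFiniteMeasure ((volume : Measure ℝ).restrict (uIoc 0 (2 * Real.pi))) := by
      rw [uIoc_of_le (by positivity)]
      infer_instance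
    exact ((integrable_comp_dot hg x).comp_snd _).mul_bdd hcont.aestronglyMeasurable
      (ae_of_all _ fun w => hC _ (S2.dot_mem_Icc _ _))
  -- With `φ` integrated last the inner integral is constant; with `φ` first the product formula
  -- applies.
  have hswap := intervalIntegral_integral_swap hint
  have hleft : ∀ φ, ∫ z, g (S2.dot x z) * legendreP ℓ (S2.dot (Y φ) z) ∂dΩ =
      ∫ z, g (S2.dot x z) * legendreP ℓ (S2.dot y z) ∂dΩ := fun φ =>
    integral_comp_dot_dot_congr (fun a b => g a * legendreP ℓ b) (hxY φ)
  have hright : ∀ z, ∫ φ in (0 : ℝ)..2 * Real.pi, g (S2.dot x z) * legendreP ℓ (S2.dot (Y φ) z) =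
      2 * Real.pi * legendreP ℓ s * (g (S2.dot x z) * legendreP ℓ (S2.dot x z)) := by
    intro z
    simp_rw [intervalIntegral.integral_const_mul, hY]
    rw [integral_legendreP_circle ℓ s _ _ _ σ hσ (hpq z)]
    ring
  have hgP : IntegrableOn (fun t => g t * legendreP ℓ t) (Icc (-1) 1) :=
    hg.mul_continuousOn (continuous_legendreP ℓ).continuousOn isCompact_Icc
  simp_rw [hleft, hright] at hswap
  rw [intervalIntegral.integral_const, integral_const_mul, integral_comp_dot hgP x, sub_zero,
    smul_eq_mul] at hswap
  exact mul_left_cancel₀ (by positivity : 2 * Real.pi ≠ 0)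
    (hswap.trans (by ring))

/-! ### Truncation and the improper integral. -/

theorem aecover_lt_one_sub {α : Type*} [MeasurableSpace α] {μ : Measure α} {h : α → ℝ}
    (hm : Measurable h) (hlt : ∀ᵐ z ∂μ, h z < 1) :
    AECover μ (𝓝[>] (0 : ℝ)) fun ε => {z | h z < 1 - ε} where
  ae_eventually_mem := hlt.mono fun z hz => by
    have : ∀ᶠ ε in 𝓝 (0 : ℝ), ε < 1 - h z := eventually_lt_nhds (by linarith)
    filter_upwards [mem_nhdsWithin_of_mem_nhds this] with ε hε
    exact (by linarith : h z < 1 - ε)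
  measurableSet := fun ε => measurableSet_lt hm measurable_const

theorem ae_dot_lt_one (x : S2) : ∀ᵐ z ∂dΩ, S2.dot x z < 1 := by
  refine (ae_map_iff (S2.continuous_dot x).measurable.aemeasurable (p := fun t => t < 1)
    measurableSet_Iio).mp ?_
  rw [map_dot]
  refine Measure.ae_smul_measure ?_ _
  have h1 : ∀ᵐ t ∂(volume : Measure ℝ), t ≠ 1 := by simp [ae_iff]
  filter_upwards [ae_restrict_mem measurableSet_Icc, ae_restrict_of_ae h1] with t ht ht1
  exact lt_of_le_of_ne ht.2 ht1

-- `P_ℓ - 1` vanishes at `1`, so it is `X - 1` times a polynomial, which is bounded on `[-1, 1]`.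
open Polynomial in
theorem integrableOn_legendreP_sub_one_mul {f : ℝ → ℝ}
    (hf : IntegrableOn (fun t : ℝ => (1 - t) * f t) (Icc (-1) 1)) (ℓ : ℕ) :
    IntegrableOn (fun t => (legendreP ℓ t - 1) * f t) (Icc (-1) 1) := by
  obtain ⟨q, hq⟩ : X - C (1 : ℝ) ∣ legendrePoly ℓ - 1 := by
    rw [dvd_iff_isRoot]
    have h := legendreP_one ℓ
    rw [legendreP] at h
    simp [h]
  have h := (hf.continuousOn_mul (q.continuous.continuousOn) isCompact_Icc).neg
  refine h.congr (ae_of_all _ fun t => ?_)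
  have h2 := congrArg (eval t) hq
  simp only [eval_sub, eval_one, eval_mul, eval_X, eval_C] at h2
  simp only [legendreP, Pi.neg_apply, h2]
  ring

/-- For `t < 1 - ε` the factor `(1 - t)⁻¹` is at most `ε⁻¹`. -/
theorem integrableOn_indicator_of_one_sub_mul {f : ℝ → ℝ}
    (hf : IntegrableOn (fun t : ℝ => (1 - t) * f t) (Icc (-1) 1)) {ε : ℝ} (hε : 0 < ε) :
    IntegrableOn ((Iio (1 - ε)).indicator f) (Icc (-1) 1) := by
  have hm : Measurable ((Iio (1 - ε)).indicator fun t : ℝ => (1 - t)⁻¹) :=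
    Measurable.indicator (by fun_prop) measurableSet_Iio
  have h := hf.bdd_mul (c := ε⁻¹) hm.aestronglyMeasurable (ae_of_all _ fun t => ?_)
  · refine h.congr (ae_of_all _ fun t => ?_)
    by_cases ht : t ∈ Iio (1 - ε)
    · have : (1 - t) ≠ 0 := by
        have : t < 1 - ε := ht
        linarith
      simp only [indicator_of_mem ht]
      field_simp
    · simp [indicator_of_notMem ht]
  · by_cases ht : t ∈ Iio (1 - ε)
    · have ht' : t < 1 - ε := ht
      rw [indicator_of_mem ht, norm_inv, Real.norm_eq_abs, abs_of_pos (by linarith)]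
      exact inv_anti₀ hε (by linarith)
    · simp [indicator_of_notMem ht, hε.le]

theorem measurableSet_offCap (x : S2) (ε : ℝ) : MeasurableSet (offCap x ε) :=
  measurableSet_lt (S2.continuous_dot x).measurable measurable_const

theorem indicator_offCap_mul (f : ℝ → ℝ) (k : S2 → ℝ) (x : S2) (ε : ℝ) :
    (offCap x ε).indicator (fun z => f (S2.dot x z) * k z) =
      fun z => (Iio (1 - ε)).indicator f (S2.dot x z) * k z := by
  ext z
  by_cases hz : z ∈ offCap x ε
  · rw [indicator_of_mem hz, indicator_of_mem (show S2.dot x z ∈ Iio (1 - ε) from hz)]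
  · rw [indicator_of_notMem hz, indicator_of_notMem (show S2.dot x z ∉ Iio (1 - ε) from hz),
      zero_mul]

theorem integrable_comp_dot_mul_legendreP {g : ℝ → ℝ} (hg : IntegrableOn g (Icc (-1) 1)) (ℓ : ℕ)
    (x y : S2) : Integrable (fun z => g (S2.dot x z) * legendreP ℓ (S2.dot y z)) dΩ := by
  obtain ⟨C, hC⟩ := isCompact_Icc.exists_bound_of_continuousOn (s := Icc (-1 : ℝ) 1)
    (continuous_legendreP ℓ).continuousOn
  exact (integrable_comp_dot hg x).mul_bdd
    ((continuous_legendreP ℓ).comp (S2.continuous_dot y)).aestronglyMeasurable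
    (ae_of_all _ fun z => hC _ (S2.dot_mem_Icc y z))

theorem integrableOn_offCap
    {f : ℝ → ℝ} (hf : IntegrableOn (fun t : ℝ => (1 - t) * f t) (Icc (-1) 1)) (ℓ : ℕ)
    (x y : S2) {ε : ℝ} (hε : 0 < ε) :
    IntegrableOn
      (fun z => f (S2.dot x z) * (legendreP ℓ (S2.dot y z) - legendreP ℓ (S2.dot x y)))
      (offCap x ε) dΩ := by
  have hg := integrableOn_indicator_of_one_sub_mul hf hε
  rw [← integrable_indicator_iff (measurableSet_offCap x ε), indicator_offCap_mul]
  simp_rw [mul_sub]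
  exact (integrable_comp_dot_mul_legendreP hg ℓ x y).sub ((integrable_comp_dot hg x).mul_const _)

theorem setIntegral_offCap
    {f : ℝ → ℝ} (hf : IntegrableOn (fun t : ℝ => (1 - t) * f t) (Icc (-1) 1)) (ℓ : ℕ)
    (x y : S2) {ε : ℝ} (hε : 0 < ε) :
    ∫ z in offCap x ε, f (S2.dot x z) * (legendreP ℓ (S2.dot y z) - legendreP ℓ (S2.dot x y)) ∂dΩ =
      2 * Real.pi * legendreP ℓ (S2.dot x y) *
        ∫ t in Iio (1 - ε), (legendreP ℓ t - 1) * f t ∂volume.restrict (Ioc (-1) 1) := by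
  have hg := integrableOn_indicator_of_one_sub_mul hf hε
  have hgP : IntegrableOn (fun t => (Iio (1 - ε)).indicator f t * legendreP ℓ t) (Icc (-1) 1) :=
    hg.mul_continuousOn (continuous_legendreP ℓ).continuousOn isCompact_Icc
  rw [← integral_indicator (measurableSet_offCap x ε), indicator_offCap_mul,
    ← integral_indicator measurableSet_Iio]
  simp_rw [mul_sub]
  rw [integral_sub (integrable_comp_dot_mul_legendreP hg ℓ x y)
    ((integrable_comp_dot hg x).mul_const _), integral_mul_const, integral_comp_dot hg x,
    integral_comp_dot_mul_legendreP hg, ← intervalIntegral.integral_of_le (by norm_num)]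
  have hsub : ∀ t, (Iio (1 - ε)).indicator (fun t => (legendreP ℓ t - 1) * f t) t =
      (Iio (1 - ε)).indicator f t * legendreP ℓ t - (Iio (1 - ε)).indicator f t := by
    intro t
    by_cases ht : t ∈ Iio (1 - ε)
    · simp only [indicator_of_mem ht]
      ring
    · simp [indicator_of_notMem ht]
  simp_rw [hsub]
  rw [intervalIntegral.integral_sub
    ((intervalIntegrable_iff_integrableOn_Icc_of_le (by norm_num)).mpr hgP)
    ((intervalIntegrable_iff_integrableOn_Icc_of_le (by norm_num)).mpr hg)]
  ring

theorem proposition1 (f : ℝ → ℝ)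
    (hf : IntegrableOn (fun t : ℝ => (1 - t) * f t) (Icc (-1) 1) volume)
    (ℓ : ℕ) (x y : S2) :
    -- the integral `γ_ℓ` converges absolutely
    IntervalIntegrable (fun t : ℝ => (legendreP ℓ t - 1) * f t) volume (-1) 1 ∧
    -- the formula, the left-hand side being an improper integral at `x`
    HasImproperIntegralAt x
      (fun z => f (S2.dot x z) * (legendreP ℓ (S2.dot y z) - legendreP ℓ (S2.dot x y)))
      (2 * Real.pi * legendreP ℓ (S2.dot x y) *
        ∫ t in (-1 : ℝ)..1, (legendreP ℓ t - 1) * f t) ∧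
    -- the formula with a Lebesgue integral, whenever that integral exists
    (Integrable
        (fun z => f (S2.dot x z) * (legendreP ℓ (S2.dot y z) - legendreP ℓ (S2.dot x y))) dΩ →
      ∫ z, f (S2.dot x z) * (legendreP ℓ (S2.dot y z) - legendreP ℓ (S2.dot x y)) ∂dΩ =
        2 * Real.pi * legendreP ℓ (S2.dot x y) *
          ∫ t in (-1 : ℝ)..1, (legendreP ℓ t - 1) * f t) := by
  have hint := integrableOn_legendreP_sub_one_mul hf ℓ
  have himp : HasImproperIntegralAt x
      (fun z => f (S2.dot x z) * (legendreP ℓ (S2.dot y z) - legendreP ℓ (S2.dot x y)))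
      (2 * Real.pi * legendreP ℓ (S2.dot x y) *
        ∫ t in (-1 : ℝ)..1, (legendreP ℓ t - 1) * f t) := by
    refine ⟨fun ε hε => integrableOn_offCap hf ℓ x y hε, ?_⟩
    have hlt : ∀ᵐ t ∂(volume : Measure ℝ).restrict (Ioc (-1) 1), t < 1 := by
      have h1 : ∀ᵐ t ∂(volume : Measure ℝ), t ≠ 1 := by simp [ae_iff]
      filter_upwards [ae_restrict_mem measurableSet_Ioc, ae_restrict_of_ae h1] with t ht ht1
      exact lt_of_le_of_ne ht.2 ht1
    have hlim := (aecover_lt_one_sub measurable_id hlt).integral_tendsto_of_countably_generated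
      (hint.mono_set Ioc_subset_Icc_self)
    rw [intervalIntegral.integral_of_le (by norm_num)]
    refine (hlim.const_mul (2 * Real.pi * legendreP ℓ (S2.dot x y))).congr' ?_
    filter_upwards [self_mem_nhdsWithin] with ε hε
    exact (setIntegral_offCap hf ℓ x y hε).symm
  refine ⟨(intervalIntegrable_iff_integrableOn_Icc_of_le (by norm_num)).mpr hint, himp, fun h => ?_⟩
  -- The truncated integrals also tend to the Lebesgue integral, so the two limits agree.
  exact (aecover_lt_one_sub (S2.continuous_dot x).measurable
    (ae_dot_lt_one x)).integral_eq_of_tendsto _ h himp.2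

end
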